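/- Work over the max-plus semiring $\mathbb{R}_{\max}=\mathbb{R}\cup\{-\infty\}$ with addition $\max$ and multiplication $+$, and write $[n]=\{1,\dots,n\}$. Let $v^1,\dots,v^p\in\mathbb{R}^n$ with $p\ge 1$, and let $\mathcal{C}=\{x\in\mathbb{R}_{\max}^n \mid x_i=\max_{r}(\lambda_r+v^r_i)\ (i\in[n]) \text{ for some } \lambda_1,\dots,\lambda_p\in\mathbb{R}_{\max}\}$ be the real polyhedral cone that they generate. Vectors of $\mathbb{R}^n$ are regarded as points of $\mathbb{R}^n/(1,\dots,1)\mathbb{R}$, i.e. up to the addition of a constant to all coordinates. Half-spaces. A (possibly degenerate) tropical half-space is a set $\{x\in\mathbb{R}_{\max}^n \mid \max_{i\in I}(x_i-\alpha_i)\ge\max_{j\in J}(x_j-\alpha_j)\}$ with $\alpha\in\mathbb{R}^n$ and $I,J\subset[n]$ non-empty and disjoint. For $a\in\mathbb{R}^n$ and $I$ a non-empty proper subset of $[n]$, the half-space $\mathcal{H}(a,I)$ with apex $a$ is the one with $\alpha=a$ and $J=[n]\setminus I$. A half-space is minimal with respect to $\mathcal{C}$ if it is minimal for inclusion among all half-spaces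 containing $\mathcal{C}$. Representations. A non-redundant external representation of $\mathcal{C}$ is a finite set $\Gamma$ of half-spaces of the form $\mathcal{H}(a,I)$, each containing $\mathcal{C}$ and with apex $a\in\mathcal{C}$, such that $\mathcal{C}=\bigcap_{\mathcal{H}\in\Gamma}\mathcal{H}$ and no $\mathcal{H}\in\Gamma$ contains the intersection of $\Gamma\setminus\{\mathcal{H}\}$ (an empty intersection being $\mathbb{R}_{\max}^n$). The non-redundant apices of $\mathcal{C}$ are the apices of the half-spaces occurring in non-redundant external representations of $\mathcal{C}$. Vertices. For $a\in\mathbb{R}^n$ and $i\in[n]$ let $S_i(a)=\{r\in[p] \mid v^r_i-a_i\ge v^r_k-a_k \text{ for all } k\in[n]\}$. For a non-empty proper subset $I$ of $[n]$ and $j\in[n]\setminus I$, the vector $a$ is an $(I,j)$-vertex of $\mathcal{C}$ if (i) $\bigcup_{i\in I}S_i(a)=[p]$; (ii) for each $k\in[n]\setminus I$ there is $i\in I$ with $S_i(a)\cap S_k(a)\ne\emptyset$; (iii) $S_i(a)\cap S_j(a)\not\subset\bigcup_{k\in I\setminus\{i\}}S_k(a)$ for every $i\in I$. Generic extremities. Let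 $d_H(x,y)=\max_i(x_i-y_i)-\min_i(x_i-y_i)$ on $\mathbb{R}^n$. The cone $\mathcal{C}$ has generic extremities if each generator $v^r$ belongs to a closed $d_H$-ball of positive radius that is included in $\mathcal{C}$. Theorem. Suppose that $\mathcal{C}$ has generic extremities. Then: 1. The non-redundant apices of $\mathcal{C}$ are precisely the vectors $a$ for which there exist a non-empty proper subset $I$ of $[n]$ and $j\in[n]\setminus I$ such that $a$ is an $(I,j)$-vertex of $\mathcal{C}$; moreover, every non-redundant external representation of $\mathcal{C}$ has exactly this set of apices. 2. For each such $a$ the set $I$ is uniquely determined: if $a$ is an $(I,j)$-vertex and an $(I',j')$-vertex of $\mathcal{C}$, then $I=I'$. 3. The collection of the half-spaces $\mathcal{H}(a,I)$, for $a$ an $(I,j)$-vertex of $\mathcal{C}$ for some $j$, is a non-redundant external representation of $\mathcal{C}$ composed of half-spaces that are minimal with respect to $\mathcal{C}$, and it is the only non-redundant external representation of $\mathcal{C}$ composed of minimal half-spaces. -/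

import Mathlib

/-! Tropical (max-plus) cones. The max-plus semiring is `WithBot ℝ`, with `⊔` as addition
and `+` as multiplication. Cones and half-spaces are subsets of `Fin n → WithBot ℝ` stable
under tropical scaling; points of the real projective space `ℝⁿ / (1, …, 1)ℝ` are given by
representatives in `Fin n → ℝ`, every notion below being invariant under adding a constant. -/

namespace TropicalCone

/-- A vector with real coordinates, seen as a max-plus vector. -/
def toMax {n : ℕ} (x : Fin n → ℝ) : Fin n → WithBot ℝ := fun i => (x i : WithBot ℝ)

/-- The real polyhedral cone generated by the real vectors `v 0, …, v (p - 1)`: all tropical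
linear combinations `⊕ᵣ lᵣ vᵣ` with coefficients in the max-plus semiring. -/
def cone {n p : ℕ} (v : Fin p → Fin n → ℝ) : Set (Fin n → WithBot ℝ) :=
  {x | ∃ l : Fin p → WithBot ℝ,
    ∀ i, x i = Finset.univ.sup (fun r => l r + ((v r i : ℝ) : WithBot ℝ))}

/-- The set `{x | max_{i ∈ I} (x i - α i) ≥ max_{j ∈ J} (x j - α j)}`. -/
def halfSpaceOf {n : ℕ} (α : Fin n → ℝ) (I J : Finset (Fin n)) : Set (Fin n → WithBot ℝ) :=
  {x | J.sup (fun j => x j + ((-α j : ℝ) : WithBot ℝ)) ≤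
    I.sup (fun i => x i + ((-α i : ℝ) : WithBot ℝ))}

/-- Tropical half-spaces, possibly degenerate (the case `I ∪ J ≠ univ`). -/
def IsHalfSpace {n : ℕ} (H : Set (Fin n → WithBot ℝ)) : Prop :=
  ∃ (α : Fin n → ℝ) (I J : Finset (Fin n)),
    I.Nonempty ∧ J.Nonempty ∧ Disjoint I J ∧ H = halfSpaceOf α I J

/-- `H(a, I)`, which for `I` non-empty and proper is the non-degenerate half-space with apex
`a` and sectors `I`. -/
def halfSpace {n : ℕ} (a : Fin n → ℝ) (I : Finset (Fin n)) : Set (Fin n → WithBot ℝ) :=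
  halfSpaceOf a I Iᶜ

/-- Half-spaces that are minimal with respect to `C`: minimal for inclusion among all
(possibly degenerate) half-spaces containing `C`. -/
def IsMinimalHalfSpace {n : ℕ} (C H : Set (Fin n → WithBot ℝ)) : Prop :=
  Minimal (fun H' => IsHalfSpace H' ∧ C ⊆ H') H

/-- The set `Σ` of non-degenerate half-spaces containing `C` with apex in `C`. -/
def supportingHalfSpaces {n : ℕ} (C : Set (Fin n → WithBot ℝ)) :
    Set (Set (Fin n → WithBot ℝ)) :=
  {H | ∃ (a : Fin n → ℝ) (I : Finset (Fin n)),
    I.Nonempty ∧ I ≠ Finset.univ ∧ H = halfSpace a I ∧ C ⊆ H ∧ toMax a ∈ C}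

/-- `Γ` is a non-redundant external representation of `C`: a finite set of half-spaces of `Σ`
with intersection `C`, none of which contains the intersection of the others. -/
def IsNonredundantRep {n : ℕ} (C : Set (Fin n → WithBot ℝ))
    (Γ : Set (Set (Fin n → WithBot ℝ))) : Prop :=
  Γ.Finite ∧ Γ ⊆ supportingHalfSpaces C ∧ ⋂₀ Γ = C ∧ ∀ H ∈ Γ, ¬ ⋂₀ (Γ \ {H}) ⊆ H

/-- The apices (all their representatives in `ℝⁿ`) of the half-spaces in `Γ`. -/
def apices {n : ℕ} (Γ : Set (Set (Fin n → WithBot ℝ))) : Set (Fin n → ℝ) :=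
  {a | ∃ I : Finset (Fin n), I.Nonempty ∧ I ≠ Finset.univ ∧ halfSpace a I ∈ Γ}

/-- The non-redundant apices of `C`: the apices of the half-spaces that occur in non-redundant
external representations of `C`. -/
def nonredundantApices {n : ℕ} (C : Set (Fin n → WithBot ℝ)) : Set (Fin n → ℝ) :=
  {a | ∃ Γ, IsNonredundantRep C Γ ∧ a ∈ apices Γ}

/-- The component `S_i(a)` of the type of `a` relative to the generators `v`. -/
def typeSet {n p : ℕ} (v : Fin p → Fin n → ℝ) (a : Fin n → ℝ) (i : Fin n) : Set (Fin p) :=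
  {r | ∀ k, v r k - a k ≤ v r i - a i}

/-- `a` is an `(I, j)`-vertex of the cone generated by `v`; `I` is proper since `j ∉ I`. -/
structure IsVertex {n p : ℕ} (v : Fin p → Fin n → ℝ) (a : Fin n → ℝ)
    (I : Finset (Fin n)) (j : Fin n) : Prop where
  nonempty : I.Nonempty
  notMem : j ∉ I
  cover : ⋃ i ∈ I, typeSet v a i = Set.univ
  touch : ∀ k, k ∉ I → ∃ i ∈ I, (typeSet v a i ∩ typeSet v a k).Nonempty
  tight : ∀ i ∈ I, ¬ typeSet v a i ∩ typeSet v a j ⊆ ⋃ k ∈ I \ {i}, typeSet v a k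

/-- The tropical projective Hilbert metric between vectors with real coordinates. -/
noncomputable def hilbertDist {n : ℕ} (x y : Fin n → ℝ) : ℝ :=
  (⨆ i, (x i - y i)) - ⨅ i, (x i - y i)

/-- The closed Hilbert ball with centre `c` and radius `ε`. -/
def hilbertBall {n : ℕ} (c : Fin n → ℝ) (ε : ℝ) : Set (Fin n → ℝ) :=
  {x | hilbertDist x c ≤ ε}

/-- The cone generated by `v` has generic extremities: each generator lies in a Hilbert ball
of positive radius that is included in the cone. -/
def HasGenericExtremities {n p : ℕ} (v : Fin p → Fin n → ℝ) : Prop :=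
  ∀ r, ∃ (c : Fin n → ℝ) (ε : ℝ), 0 < ε ∧ v r ∈ hilbertBall c ε ∧
    ∀ x ∈ hilbertBall c ε, toMax x ∈ cone v

/-- The collection of the half-spaces `H(a, I)` for `a` an `(I, j)`-vertex. -/
def vertexHalfSpaces {n p : ℕ} (v : Fin p → Fin n → ℝ) : Set (Set (Fin n → WithBot ℝ)) :=
  {H | ∃ (a : Fin n → ℝ) (I : Finset (Fin n)) (j : Fin n), IsVertex v a I j ∧ H = halfSpace a I}

end TropicalCone

/-! Say that `r` has type `k` at `a` when `r ∈ typeSet v a k`. Genericity enters through corners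
(`HasGenericExtremities.exists_isCorner_typeSet`): if `H(a, I)` contains the cone and `r` has type
`j ∉ I`, some generator `s` of type `j` has only types of `r`, all in `I ∪ {j}`, and moves inside
the cone down along `j` and up along every other coordinate.

At an `(I, j)`-vertex `a` this gives, for each `i ∈ I`, a generator of types exactly `i` and `j`
that can be lowered at `j`. Once lowered it lies in sector `i` only, so every half-space with apex
`a` that contains the cone has `I` among its sectors; hence `I` is unique. The same generators show
that a small raise of `a` at `j` leaves `H(a, I)` but no given supporting half-space with another
apex. By finiteness, `a` is an apex of every finite representation.

Conversely, let `H(a, I)` occur in a non-redundant representation, and let `x` lie outside it but in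
all the other half-spaces. Joining generators with translates of `x` gives points of the cone, and
the generators attaining their coordinate `j` have controlled types. Corners refine these to types
`{i, j}`; the `i` that occur form `J ⊆ I`, and `a` is a `(J, j)`-vertex. Since `H(a, J) ⊆ H(a, I)`,
the vertex half-spaces also cut out the cone, and minimality singles them out. -/

namespace TropicalCone

variable {n p : ℕ}

/-! ### Membership -/

theorem withBot_add_neg_le_iff (x y : WithBot ℝ) (c d : ℝ) :
    x + ((-c : ℝ) : WithBot ℝ) ≤ y + ((-d : ℝ) : WithBot ℝ) ↔ x + ((d - c : ℝ) : WithBot ℝ) ≤ y := by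
  induction x using WithBot.recBotCoe with
  | bot => simp
  | coe x =>
    induction y using WithBot.recBotCoe with
    | bot =>
      rw [WithBot.bot_add, ← WithBot.coe_add, ← WithBot.coe_add]
      simp only [le_bot_iff, WithBot.coe_ne_bot]
    | coe y =>
      norm_cast
      constructor <;> intro h <;> linarith

theorem mem_halfSpaceOf_iff {α : Fin n → ℝ} {I J : Finset (Fin n)} (hI : I.Nonempty)
    {x : Fin n → WithBot ℝ} :
    x ∈ halfSpaceOf α I J ↔
      ∀ j ∈ J, ∃ i ∈ I, x j + ((-α j : ℝ) : WithBot ℝ) ≤ x i + ((-α i : ℝ) : WithBot ℝ) := by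
  simp only [halfSpaceOf, Set.mem_ofPred_eq, Finset.sup_le_iff]
  refine forall₂_congr fun j _ => ⟨fun h => ?_, fun ⟨i, hi, h⟩ => h.trans ?_⟩
  · obtain ⟨i, hi, e⟩ := Finset.exists_mem_eq_sup I hI
      (fun i => x i + ((-α i : ℝ) : WithBot ℝ))
    exact ⟨i, hi, e ▸ h⟩
  · exact Finset.le_sup (f := fun i => x i + ((-α i : ℝ) : WithBot ℝ)) hi

theorem toMax_mem_halfSpaceOf_iff {α : Fin n → ℝ} {I J : Finset (Fin n)} (hI : I.Nonempty)
    {x : Fin n → ℝ} :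
    toMax x ∈ halfSpaceOf α I J ↔ ∀ j ∈ J, ∃ i ∈ I, x j - α j ≤ x i - α i := by
  rw [mem_halfSpaceOf_iff hI]
  refine forall₂_congr fun j _ => exists_congr fun i => and_congr_right fun _ => ?_
  simp only [toMax]
  norm_cast

theorem mem_halfSpace_iff {a : Fin n → ℝ} {I : Finset (Fin n)} (hI : I.Nonempty)
    {x : Fin n → WithBot ℝ} :
    x ∈ halfSpace a I ↔
      ∀ j ∉ I, ∃ i ∈ I, x j + ((-a j : ℝ) : WithBot ℝ) ≤ x i + ((-a i : ℝ) : WithBot ℝ) := by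
  simp [halfSpace, mem_halfSpaceOf_iff hI]

theorem toMax_mem_halfSpace_iff {a : Fin n → ℝ} {I : Finset (Fin n)} (hI : I.Nonempty)
    {x : Fin n → ℝ} :
    toMax x ∈ halfSpace a I ↔ ∀ j ∉ I, ∃ i ∈ I, x j - a j ≤ x i - a i := by
  simp [halfSpace, toMax_mem_halfSpaceOf_iff hI]

/-- Residuation: the largest coefficient that keeps `v r` below `x` is `min_k (x k - v r k)`, and
`x` is in the cone exactly when these coefficients reach every coordinate. -/
theorem mem_cone_iff (hp : 0 < p) {v : Fin p → Fin n → ℝ} {x : Fin n → WithBot ℝ} :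
    x ∈ cone v ↔
      ∀ i, ∃ r, ∀ k, x i + ((-v r i : ℝ) : WithBot ℝ) ≤ x k + ((-v r k : ℝ) : WithBot ℝ) := by
  have : Nonempty (Fin p) := ⟨⟨0, hp⟩⟩
  constructor
  · rintro ⟨l, hl⟩ i
    obtain ⟨r, -, e⟩ := Finset.exists_mem_eq_sup Finset.univ Finset.univ_nonempty
      (fun r => l r + ((v r i : ℝ) : WithBot ℝ))
    refine ⟨r, fun k => ?_⟩
    have h1 : l r + ((v r k : ℝ) : WithBot ℝ) ≤ x k := by
      rw [hl k]
      exact Finset.le_sup (f := fun r => l r + ((v r k : ℝ) : WithBot ℝ)) (Finset.mem_univ r)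
    rw [withBot_add_neg_le_iff, hl i, e, add_assoc, ← WithBot.coe_add]
    simpa using h1
  · intro h
    rcases isEmpty_or_nonempty (Fin n) with hn | hn
    · exact ⟨fun _ => ⊥, fun i => hn.elim i⟩
    refine ⟨fun r => Finset.univ.inf' Finset.univ_nonempty
      (fun k => x k + ((-v r k : ℝ) : WithBot ℝ)), fun i => le_antisymm ?_ ?_⟩
    · obtain ⟨r, hr⟩ := h i
      refine le_trans ?_ (Finset.le_sup (Finset.mem_univ r))
      have : x i + ((-v r i : ℝ) : WithBot ℝ) ≤ Finset.univ.inf' Finset.univ_nonempty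
          (fun k => x k + ((-v r k : ℝ) : WithBot ℝ)) :=
        Finset.le_inf' _ _ fun k _ => hr k
      calc x i = x i + ((-v r i : ℝ) : WithBot ℝ) + ((v r i : ℝ) : WithBot ℝ) := by
            rw [add_assoc, ← WithBot.coe_add]; simp
        _ ≤ _ := by gcongr
    · refine Finset.sup_le fun r _ => ?_
      have : Finset.univ.inf' Finset.univ_nonempty
          (fun k => x k + ((-v r k : ℝ) : WithBot ℝ)) ≤ x i + ((-v r i : ℝ) : WithBot ℝ) :=
        Finset.inf'_le _ (Finset.mem_univ i)
      calc _ ≤ x i + ((-v r i : ℝ) : WithBot ℝ) + ((v r i : ℝ) : WithBot ℝ) := by gcongr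
        _ = x i := by rw [add_assoc, ← WithBot.coe_add]; simp

theorem toMax_mem_cone_iff (hp : 0 < p) {v : Fin p → Fin n → ℝ} {x : Fin n → ℝ} :
    toMax x ∈ cone v ↔ ∀ i, ∃ r, ∀ k, x i - v r i ≤ x k - v r k := by
  rw [mem_cone_iff hp]
  refine forall_congr' fun i => exists_congr fun r => forall_congr' fun k => ?_
  simp only [toMax]
  norm_cast

theorem toMax_generator_mem_cone (v : Fin p → Fin n → ℝ) (r : Fin p) :
    toMax (v r) ∈ cone v :=
  (toMax_mem_cone_iff r.pos).2 fun _ => ⟨r, fun _ => by simp⟩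

theorem cone_subset_halfSpaceOf_iff (hp : 0 < p) {v : Fin p → Fin n → ℝ} {α : Fin n → ℝ}
    {I J : Finset (Fin n)} (hI : I.Nonempty) :
    cone v ⊆ halfSpaceOf α I J ↔ ∀ r, ∀ j ∈ J, ∃ i ∈ I, v r j - α j ≤ v r i - α i := by
  constructor
  · exact fun h r => (toMax_mem_halfSpaceOf_iff hI).1 (h (toMax_generator_mem_cone v r))
  · intro h x hx
    rw [mem_halfSpaceOf_iff hI]
    intro j hj
    obtain ⟨r, hr⟩ := (mem_cone_iff hp).1 hx j
    obtain ⟨i, hi, h1⟩ := h r j hj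
    refine ⟨i, hi, ?_⟩
    have h2 := hr i
    rw [withBot_add_neg_le_iff] at h2 ⊢
    refine le_trans ?_ h2
    exact add_le_add le_rfl (WithBot.coe_le_coe.2 (by linarith))

theorem cone_subset_halfSpace_iff (hp : 0 < p) {v : Fin p → Fin n → ℝ} {a : Fin n → ℝ}
    {I : Finset (Fin n)} (hI : I.Nonempty) :
    cone v ⊆ halfSpace a I ↔ ∀ r, ∃ i ∈ I, r ∈ typeSet v a i := by
  simp only [halfSpace, cone_subset_halfSpaceOf_iff hp hI, Finset.mem_compl, typeSet,
    Set.mem_ofPred_eq]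
  refine forall_congr' fun r => ⟨fun h => ?_, fun ⟨i, hi, h⟩ j _ => ⟨i, hi, h j⟩⟩
  obtain ⟨i, hi, hmax⟩ := Finset.exists_max_image I (fun i => v r i - a i) hI
  refine ⟨i, hi, fun k => ?_⟩
  by_cases hk : k ∈ I
  · exact hmax k hk
  · obtain ⟨i', hi', h'⟩ := h k hk
    exact h'.trans (hmax i' hi')

/-! ### Invariance under the addition of constants -/

theorem halfSpace_eq_of_sub_const {a b : Fin n → ℝ} {c : ℝ} (h : ∀ k, a k = b k + c)
    {I : Finset (Fin n)} (hI : I.Nonempty) : halfSpace a I = halfSpace b I := by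
  ext x
  simp only [mem_halfSpace_iff hI, withBot_add_neg_le_iff, h, add_sub_add_right_eq_sub]

theorem toMax_mem_cone_of_sub_const (hp : 0 < p) {v : Fin p → Fin n → ℝ} {a b : Fin n → ℝ}
    {c : ℝ} (h : ∀ k, a k = b k + c) (hb : toMax b ∈ cone v) : toMax a ∈ cone v := by
  rw [toMax_mem_cone_iff hp] at hb ⊢
  intro i
  obtain ⟨r, hr⟩ := hb i
  exact ⟨r, fun k => by linarith [hr k, h i, h k]⟩

theorem typeSet_eq_of_sub_const {v : Fin p → Fin n → ℝ} {a b : Fin n → ℝ} {c : ℝ}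
    (h : ∀ k, a k = b k + c) : typeSet v a = typeSet v b := by
  ext i r
  simp only [typeSet, Set.mem_ofPred_eq, h]
  exact forall_congr' fun k => ⟨fun h => by linarith, fun h => by linarith⟩

theorem IsVertex.of_sub_const {v : Fin p → Fin n → ℝ} {a b : Fin n → ℝ} {c : ℝ}
    (h : ∀ k, a k = b k + c) {I : Finset (Fin n)} {j : Fin n} (hb : IsVertex v b I j) :
    IsVertex v a I j := by
  obtain ⟨h1, h2, h3, h4, h5⟩ := hb
  rw [← typeSet_eq_of_sub_const h] at h3 h4 h5
  exact ⟨h1, h2, h3, h4, h5⟩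

/-! ### Inclusions between half-spaces -/

/-- The max-plus vector with coordinates `s` at `i`, `t` at `j` and `-∞` elsewhere. -/
noncomputable def pairVec (i j : Fin n) (s t : ℝ) : Fin n → WithBot ℝ :=
  fun k => if k = i then (s : WithBot ℝ) else if k = j then (t : WithBot ℝ) else ⊥

theorem pairVec_mem_halfSpaceOf_iff {α : Fin n → ℝ} {I J : Finset (Fin n)} (hIJ : Disjoint I J)
    {i j : Fin n} (hi : i ∈ I) (hj : j ∈ J) {s t : ℝ} :
    pairVec i j s t ∈ halfSpaceOf α I J ↔ t - α j ≤ s - α i := by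
  have hij : j ≠ i := fun h => Finset.disjoint_left.1 hIJ hi (h ▸ hj)
  rw [mem_halfSpaceOf_iff ⟨i, hi⟩]
  constructor
  · intro h
    obtain ⟨k, hk, h⟩ := h j hj
    have hkj : k ≠ j := fun h => Finset.disjoint_left.1 hIJ hk (h ▸ hj)
    by_cases hki : k = i
    · subst hki
      simp only [pairVec, hij, if_true, if_false] at h
      exact_mod_cast h
    · simp only [pairVec, hij, hki, hkj, if_true, if_false, WithBot.bot_add, le_bot_iff,
        ← WithBot.coe_add, WithBot.coe_ne_bot] at h
  · intro h k hk
    refine ⟨i, hi, ?_⟩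
    have hki : k ≠ i := fun h => Finset.disjoint_left.1 hIJ hi (h ▸ hk)
    by_cases hkj : k = j
    · subst hkj
      simp only [pairVec, hij, if_true, if_false]
      exact_mod_cast h
    · simp [pairVec, hki, hkj]

theorem single_mem_halfSpaceOf_iff {α : Fin n → ℝ} {I J : Finset (Fin n)} (hI : I.Nonempty)
    (hIJ : Disjoint I J) {i : Fin n} :
    pairVec i i 0 0 ∈ halfSpaceOf α I J ↔ i ∉ J := by
  rw [mem_halfSpaceOf_iff hI]
  constructor
  · intro h hi
    obtain ⟨k, hk, h⟩ := h i hi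
    have hki : k ≠ i := fun h => Finset.disjoint_left.1 hIJ hk (h ▸ hi)
    simp only [pairVec, hki, if_true, if_false, WithBot.bot_add, le_bot_iff,
        ← WithBot.coe_add, WithBot.coe_ne_bot] at h
  · intro hi k hk
    obtain ⟨i', hi'⟩ := hI
    have hki : k ≠ i := fun h => hi (h ▸ hk)
    exact ⟨i', hi', by simp [pairVec, hki]⟩

/-- Vectors with a single finite coordinate compare the index sets; those with two compare the
parameters. -/
theorem halfSpaceOf_subset_halfSpace {α a : Fin n → ℝ} {I₀ J₀ I : Finset (Fin n)}
    (hI₀ : I₀.Nonempty) (hIJ : Disjoint I₀ J₀) (hI : I.Nonempty)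
    (h : halfSpaceOf α I₀ J₀ ⊆ halfSpace a I) :
    I₀ ⊆ I ∧ Iᶜ ⊆ J₀ ∧ ∀ i ∈ I₀, ∀ j ∉ I, a i - a j ≤ α i - α j := by
  have hJ : Iᶜ ⊆ J₀ := by
    intro j hj
    by_contra hj'
    exact (single_mem_halfSpaceOf_iff hI disjoint_compl_right).1
      (h ((single_mem_halfSpaceOf_iff hI₀ hIJ).2 hj')) hj
  have hI' : I₀ ⊆ I := by
    intro i hi
    by_contra hi'
    exact Finset.disjoint_left.1 hIJ hi (hJ (Finset.mem_compl.2 hi'))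
  refine ⟨hI', hJ, fun i hi j hj => ?_⟩
  have hj' := Finset.mem_compl.2 hj
  have := (pairVec_mem_halfSpaceOf_iff (α := a) (s := α i) (t := α j)
    (disjoint_compl_right (a := I)) (hI' hi) hj').1
    (h ((pairVec_mem_halfSpaceOf_iff hIJ hi (hJ hj')).2 (by simp)))
  linarith

theorem halfSpace_injective {a b : Fin n → ℝ} {I J : Finset (Fin n)} (hI : I.Nonempty)
    (hI' : I ≠ Finset.univ) (hJ : J.Nonempty) (h : halfSpace a I = halfSpace b J) :
    I = J ∧ ∃ c, ∀ k, a k = b k + c := by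
  obtain ⟨h1, -, h3⟩ := halfSpaceOf_subset_halfSpace hI disjoint_compl_right hJ h.subset
  obtain ⟨h4, -, h6⟩ := halfSpaceOf_subset_halfSpace hJ disjoint_compl_right hI h.symm.subset
  obtain rfl := h1.antisymm h4
  refine ⟨rfl, ?_⟩
  obtain ⟨i, hi⟩ := hI
  obtain ⟨j, hj⟩ : ∃ j, j ∉ I := by
    by_contra! hc
    exact hI' (Finset.eq_univ_iff_forall.2 hc)
  refine ⟨a i - b i, fun k => ?_⟩
  by_cases hk : k ∈ I
  · linarith [h3 i hi j hj, h6 i hi j hj, h3 k hk j hj, h6 k hk j hj]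
  · linarith [h3 i hi k hk, h6 i hi k hk]

theorem halfSpace_mono {a : Fin n → ℝ} {I J : Finset (Fin n)} (hI : I.Nonempty) (h : I ⊆ J) :
    halfSpace a I ⊆ halfSpace a J := by
  intro x hx
  rw [mem_halfSpace_iff hI] at hx
  rw [mem_halfSpace_iff (hI.mono h)]
  intro j hj
  obtain ⟨i, hi, hx⟩ := hx j fun hj' => hj (h hj')
  exact ⟨i, h hi, hx⟩

/-! ### Generic extremities -/

/-- The vector `x` with `t` added to its coordinate `j`. -/
def bump (x : Fin n → ℝ) (j : Fin n) (t : ℝ) : Fin n → ℝ := Function.update x j (x j + t)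

@[simp] theorem bump_self (x : Fin n → ℝ) (j : Fin n) (t : ℝ) : bump x j t j = x j + t := by
  simp [bump]

theorem bump_of_ne (x : Fin n → ℝ) {j k : Fin n} (t : ℝ) (h : k ≠ j) : bump x j t k = x k := by
  simp [bump, h]

theorem bump_of_mem (x : Fin n → ℝ) {j k : Fin n} (t : ℝ) {I : Finset (Fin n)} (hk : k ∈ I)
    (hj : j ∉ I) : bump x j t k = x k :=
  bump_of_ne x t (ne_of_mem_of_not_mem hk hj)

theorem mem_hilbertBall_iff [Nonempty (Fin n)] {c x : Fin n → ℝ} {ε : ℝ} :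
    x ∈ hilbertBall c ε ↔ ∀ i k, (x i - c i) - (x k - c k) ≤ ε := by
  simp only [hilbertBall, hilbertDist, Set.mem_ofPred_eq]
  have hf := Set.finite_range fun i => x i - c i
  constructor
  · intro h i k
    have h1 : x i - c i ≤ ⨆ i, (x i - c i) := le_ciSup hf.bddAbove i
    have h2 : ⨅ i, (x i - c i) ≤ x k - c k := ciInf_le hf.bddBelow k
    linarith
  · intro h
    have h1 : ⨆ i, (x i - c i) ≤ ε + ⨅ i, (x i - c i) := by
      refine ciSup_le fun i => ?_
      have : x i - c i - ε ≤ ⨅ i, (x i - c i) := le_ciInf fun k => by linarith [h i k]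
      linarith
    linarith

/-- The generator `v r` can be lowered at `j`, and raised at every other coordinate, within the
cone. -/
def IsCorner (v : Fin p → Fin n → ℝ) (r : Fin p) (j : Fin n) : Prop :=
  (∃ δ > 0, toMax (bump (v r) j (-δ)) ∈ cone v) ∧
    ∀ k ≠ j, ∃ δ > 0, toMax (bump (v r) k δ) ∈ cone v

theorem HasGenericExtremities.exists_isCorner {v : Fin p → Fin n → ℝ}
    (hv : HasGenericExtremities v) (r : Fin p) (j : Fin n) :
    ∃ s, (∀ k, v s k - v s j ≤ v r k - v r j) ∧
      ((∃ δ > 0, toMax (bump (v s) j δ) ∈ cone v) ∨ IsCorner v s j) := by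
  classical
  have : Nonempty (Fin n) := ⟨j⟩
  -- Normalised at `j`, `v s` is a generator of least coordinate sum below `v r`.
  obtain ⟨s, hs, hmin⟩ := Finset.exists_min_image
    (Finset.univ.filter fun s => ∀ k, v s k - v s j ≤ v r k - v r j)
    (fun s => ∑ k, (v s k - v s j)) ⟨r, by simp⟩
  simp only [Finset.mem_filter, Finset.mem_univ, true_and] at hs hmin
  refine ⟨s, hs, ?_⟩
  obtain ⟨c, ε, hε, hsb, hball⟩ := hv s
  rw [mem_hilbertBall_iff] at hsb
  have raise : ∀ k l, v s k - c k < v s l - c l →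
      ∃ δ > 0, toMax (bump (v s) k δ) ∈ cone v := by
    intro k l h
    -- Coordinate `k` rises just to the level of `l`, so the spread around `c` does not grow.
    refine ⟨(v s l - c l) - (v s k - c k), by linarith, hball _ (mem_hilbertBall_iff.2 ?_)⟩
    intro x y
    have hx : bump (v s) k (v s l - c l - (v s k - c k)) x - c x ≤ v s x - c x ∨
        bump (v s) k (v s l - c l - (v s k - c k)) x - c x ≤ v s l - c l := by
      by_cases hx : x = k
      · subst hx; right; rw [bump_self]; linarith
      · left; rw [bump_of_ne _ _ hx]
    have hy : v s y - c y ≤ bump (v s) k (v s l - c l - (v s k - c k)) y - c y := by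
      by_cases hy : y = k
      · subst hy; rw [bump_self]; linarith
      · rw [bump_of_ne _ _ hy]
    rcases hx with hx | hx
    · linarith [hsb x y]
    · linarith [hsb l y]
  have lower : ∀ k, (∀ l, v s l - c l ≤ v s k - c k) → toMax (bump (v s) k (-ε)) ∈ cone v := by
    intro k h
    refine hball _ (mem_hilbertBall_iff.2 fun x y => ?_)
    have hx : bump (v s) k (-ε) x - c x ≤ v s x - c x := by
      by_cases hx : x = k
      · subst hx; rw [bump_self]; linarith
      · rw [bump_of_ne _ _ hx]
    by_cases hy : y = k
    · subst hy
      rw [bump_self]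
      by_cases hxy : x = y
      · subst hxy; rw [bump_self]; linarith
      · linarith [h x]
    · rw [bump_of_ne _ _ hy]
      linarith [hsb x y]
  by_cases hj : ∃ l, v s j - c j < v s l - c l
  · exact Or.inl (raise j _ hj.choose_spec)
  push Not at hj
  refine Or.inr ⟨⟨ε, hε, lower j hj⟩, fun k hk => raise k j ?_⟩
  -- If `k` were maximal too, `v s` lowered at `k` would stay in the cone, and a generator attaining
  -- its coordinate `j` would have a smaller sum than `s`.
  by_contra! hkj
  have hmem := lower k fun l => (hj l).trans hkj
  obtain ⟨t, ht⟩ := (toMax_mem_cone_iff r.pos).1 hmem j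
  rw [bump_of_ne _ _ hk.symm] at ht
  have hle : ∀ l, v t l - v t j ≤ v s l - v s j := by
    intro l
    by_cases hl : l = k
    · subst hl
      linarith [ht l, bump_self (v s) l (-ε)]
    · linarith [ht l, bump_of_ne (v s) (-ε) hl]
  refine absurd (hmin t fun l => (hle l).trans (hs l)) (not_le.2 ?_)
  refine Finset.sum_lt_sum (fun l _ => hle l) ⟨k, Finset.mem_univ k, ?_⟩
  linarith [ht k, bump_self (v s) k (-ε)]

/-- Normalised at `j`, `v s` lies below `v r`, so `s` has no type that `r` lacks. Raising `v s` at a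
type outside `I` would leave the half-space, which excludes every such type but `j`. -/
theorem HasGenericExtremities.exists_isCorner_typeSet {v : Fin p → Fin n → ℝ}
    (hv : HasGenericExtremities v) {a : Fin n → ℝ} {I : Finset (Fin n)} (hI : I.Nonempty)
    (hC : cone v ⊆ halfSpace a I) {j : Fin n} (hj : j ∉ I) {r : Fin p}
    (hr : r ∈ typeSet v a j) :
    ∃ s, s ∈ typeSet v a j ∧ (∀ k, s ∈ typeSet v a k → r ∈ typeSet v a k) ∧
      (∀ k ≠ j, s ∈ typeSet v a k → k ∈ I) ∧ IsCorner v s j := by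
  obtain ⟨s, hs, h⟩ := hv.exists_isCorner r j
  have hsj : s ∈ typeSet v a j := fun k => by linarith [hr k, hs k]
  have key : ∀ k ∉ I, s ∈ typeSet v a k → ∀ δ > 0, toMax (bump (v s) k δ) ∉ cone v := by
    intro k hk hsk δ hδ hmem
    obtain ⟨i, hi, h1⟩ := (toMax_mem_halfSpace_iff hI).1 (hC hmem) k hk
    rw [bump_self, bump_of_mem _ _ hi hk] at h1
    linarith [hsk i]
  have hcor : IsCorner v s j := h.resolve_left fun ⟨δ, hδ, h⟩ => key j hj hsj δ hδ h
  refine ⟨s, hsj, fun k hk l => ?_, fun k hkj hk => ?_, hcor⟩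
  · linarith [hr l, hs k, hk j]
  · by_contra hkI
    obtain ⟨δ, hδ, h⟩ := hcor.2 k hkj
    exact key k hkI hk δ hδ h

/-! ### Vertices -/

theorem IsVertex.cone_subset {v : Fin p → Fin n → ℝ} (hp : 0 < p) {a : Fin n → ℝ}
    {I : Finset (Fin n)} {j : Fin n} (h : IsVertex v a I j) : cone v ⊆ halfSpace a I := by
  rw [cone_subset_halfSpace_iff hp h.nonempty]
  intro r
  have : r ∈ ⋃ i ∈ I, typeSet v a i := h.cover ▸ Set.mem_univ r
  simpa using this

theorem IsVertex.ne_univ {v : Fin p → Fin n → ℝ} {a : Fin n → ℝ}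
    {I : Finset (Fin n)} {j : Fin n} (h : IsVertex v a I j) : I ≠ Finset.univ :=
  fun hI => h.notMem (hI ▸ Finset.mem_univ j)

theorem toMax_mem_cone_iff_typeSet {v : Fin p → Fin n → ℝ} (hp : 0 < p) {a : Fin n → ℝ} :
    toMax a ∈ cone v ↔ ∀ k, (typeSet v a k).Nonempty := by
  rw [toMax_mem_cone_iff hp]
  refine forall_congr' fun k => exists_congr fun r => forall_congr' fun l => ?_
  constructor <;> intro h <;> linarith

theorem IsVertex.toMax_mem_cone {v : Fin p → Fin n → ℝ} (hp : 0 < p) {a : Fin n → ℝ}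
    {I : Finset (Fin n)} {j : Fin n} (h : IsVertex v a I j) : toMax a ∈ cone v := by
  rw [toMax_mem_cone_iff_typeSet hp]
  intro k
  by_cases hk : k ∈ I
  · obtain ⟨r, hr, -⟩ := Set.not_subset.1 (h.tight k hk)
    exact ⟨r, hr.1⟩
  · obtain ⟨i, -, r, hr⟩ := h.touch k hk
    exact ⟨r, hr.2⟩

/-- Tightness gives a generator of type `j` whose only type in `I` is `i`; passing to a corner
removes the other types outside `I`. -/
theorem IsVertex.exists_typeSet_iff {v : Fin p → Fin n → ℝ} (hv : HasGenericExtremities v)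
    {a : Fin n → ℝ} {I : Finset (Fin n)} {j : Fin n} (h : IsVertex v a I j)
    {i : Fin n} (hi : i ∈ I) :
    ∃ s, (∀ k, s ∈ typeSet v a k ↔ k = i ∨ k = j) ∧
      ∃ δ > 0, toMax (bump (v s) j (-δ)) ∈ cone v := by
  obtain ⟨r, ⟨hri, hrj⟩, hr⟩ := Set.not_subset.1 (h.tight i hi)
  have hr' : ∀ k ∈ I, r ∈ typeSet v a k → k = i := by
    intro k hk hrk
    by_contra hki
    exact hr (Set.mem_biUnion (by simpa using ⟨hk, hki⟩) hrk)
  obtain ⟨s, hsj, hsr, hsI, hc⟩ :=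
    hv.exists_isCorner_typeSet h.nonempty (h.cone_subset r.pos) h.notMem hrj
  obtain ⟨i', hi', hsi'⟩ :=
    (cone_subset_halfSpace_iff r.pos h.nonempty).1 (h.cone_subset r.pos) s
  obtain rfl := hr' i' hi' (hsr i' hsi')
  refine ⟨s, fun k => ⟨fun hk => ?_, ?_⟩, hc.1⟩
  · by_cases hkj : k = j
    · exact Or.inr hkj
    · exact Or.inl (hr' k (hsI k hkj hk) (hsr k hk))
  · rintro (rfl | rfl) <;> assumption

theorem IsVertex.subset_of_cone_subset {v : Fin p → Fin n → ℝ} (hv : HasGenericExtremities v)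
    {a : Fin n → ℝ} {I : Finset (Fin n)} {j : Fin n} (h : IsVertex v a I j)
    {J : Finset (Fin n)} (hJ : J.Nonempty) (hC : cone v ⊆ halfSpace a J) : I ⊆ J := by
  intro i hi
  by_contra hiJ
  obtain ⟨s, hs, δ, hδ, hmem⟩ := h.exists_typeSet_iff hv hi
  have hij : i ≠ j := fun e => h.notMem (e ▸ hi)
  obtain ⟨k, hk, hle⟩ := (toMax_mem_halfSpace_iff hJ).1 (hC hmem) i hiJ
  have hsi : s ∈ typeSet v a i := (hs i).2 (Or.inl rfl)
  rw [bump_of_ne _ _ hij] at hle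
  by_cases hkj : k = j
  · subst hkj
    rw [bump_self] at hle
    linarith [hsi k]
  · rw [bump_of_ne _ _ hkj] at hle
    have hsk : s ∈ typeSet v a k := fun l => (hsi l).trans hle
    rcases (hs k).1 hsk with rfl | rfl
    · exact hiJ hk
    · exact hkj rfl

theorem IsVertex.sectors_unique {v : Fin p → Fin n → ℝ} (hp : 0 < p)
    (hv : HasGenericExtremities v) {a : Fin n → ℝ} {I I' : Finset (Fin n)} {j j' : Fin n}
    (h : IsVertex v a I j) (h' : IsVertex v a I' j') : I = I' :=
  (h.subset_of_cone_subset hv h'.nonempty (h'.cone_subset hp)).antisymm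
    (h'.subset_of_cone_subset hv h.nonempty (h.cone_subset hp))

-- Only a half-space with apex `a` can separate `a` from its small raises at `j`.
open Filter Topology in
theorem IsVertex.eventually_bump_mem {v : Fin p → Fin n → ℝ} (hp : 0 < p)
    (hv : HasGenericExtremities v) {a : Fin n → ℝ} {I : Finset (Fin n)} {j : Fin n}
    (h : IsVertex v a I j) {b : Fin n → ℝ} {J : Finset (Fin n)} (hJ : J.Nonempty)
    (hC : cone v ⊆ halfSpace b J) (hb : toMax b ∈ cone v) (hab : ¬ ∃ c, ∀ k, a k = b k + c) :
    ∀ᶠ δ in 𝓝[>] (0 : ℝ), toMax (bump a j δ) ∈ halfSpace b J := by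
  have ha := (toMax_mem_halfSpace_iff hJ).1 (hC (h.toMax_mem_cone hp))
  have hpos : ∀ᶠ δ in 𝓝[>] (0 : ℝ), 0 < δ := eventually_mem_nhdsWithin
  have hle : ∀ δ > 0, ∀ k, a k ≤ bump a j δ k := by
    intro δ hδ k
    by_cases hk : k = j
    · subst hk; rw [bump_self]; linarith
    · rw [bump_of_ne _ _ hk]
  by_cases hj : j ∈ J
  · filter_upwards [hpos] with δ hδ
    rw [toMax_mem_halfSpace_iff hJ]
    intro k hk
    obtain ⟨i, hi, hki⟩ := ha k hk
    refine ⟨i, hi, ?_⟩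
    rw [bump_of_ne _ _ (ne_of_mem_of_not_mem hj hk).symm]
    linarith [hle δ hδ i]
  obtain ⟨i₀, hi₀, hmax⟩ := Finset.exists_max_image J (fun i => a i - b i) hJ
  have hmax' : ∀ k, a k - b k ≤ a i₀ - b i₀ := by
    intro k
    by_cases hk : k ∈ J
    · exact hmax k hk
    · obtain ⟨i, hi, hki⟩ := ha k hk
      exact hki.trans (hmax i hi)
  rcases (hmax' j).lt_or_eq with hlt | heq
  · have hgap : ∀ᶠ δ in 𝓝[>] (0 : ℝ), δ < (a i₀ - b i₀) - (a j - b j) :=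
      eventually_nhdsWithin_of_eventually_nhds (eventually_lt_nhds (by linarith))
    filter_upwards [hpos, hgap] with δ hδ hδ'
    rw [toMax_mem_halfSpace_iff hJ]
    intro k hk
    refine ⟨i₀, hi₀, ?_⟩
    rw [bump_of_mem _ _ hi₀ hj]
    by_cases hkj : k = j
    · subst hkj; rw [bump_self]; linarith
    · rw [bump_of_ne _ _ hkj]; exact hmax' k
  -- Here `j ∉ J` attains the maximum of `a - b`. Generators of types `{i, j}` carry this maximum to
  -- all of `I`, and `b` being in the cone carries it to every coordinate.
  · exfalso
    have hI : ∀ i ∈ I, a i - b i = a i₀ - b i₀ := by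
      intro i hi
      obtain ⟨s, hs, -⟩ := h.exists_typeSet_iff hv hi
      have hsj : s ∈ typeSet v a j := (hs j).2 (Or.inr rfl)
      obtain ⟨k, hk, hjk⟩ :=
        (toMax_mem_halfSpace_iff hJ).1 (hC (toMax_generator_mem_cone v s)) j hj
      have hsk : s ∈ typeSet v a k := fun l => by linarith [hsj l, hmax' k]
      rcases (hs k).1 hsk with rfl | rfl
      · exact le_antisymm (hmax' k) (by linarith [hsj k])
      · exact absurd hk hj
    refine hab ⟨a i₀ - b i₀, fun k => ?_⟩
    obtain ⟨r, hr⟩ := (toMax_mem_cone_iff hp).1 hb k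
    obtain ⟨i, hi, hri⟩ := (cone_subset_halfSpace_iff hp h.nonempty).1 (h.cone_subset hp) r
    linarith [hr i, hri k, hI i hi, hmax' k]

theorem IsVertex.bump_notMem {v : Fin p → Fin n → ℝ} {a : Fin n → ℝ}
    {I : Finset (Fin n)} {j : Fin n} (h : IsVertex v a I j) {δ : ℝ} (hδ : 0 < δ) :
    toMax (bump a j δ) ∉ halfSpace a I := by
  rw [toMax_mem_halfSpace_iff h.nonempty]
  intro hc
  obtain ⟨i, hi, hle⟩ := hc j h.notMem
  rw [bump_self, bump_of_mem _ _ hi h.notMem] at hle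
  linarith

theorem IsVertex.exists_halfSpace_mem {v : Fin p → Fin n → ℝ} (hp : 0 < p)
    (hv : HasGenericExtremities v) {a : Fin n → ℝ} {I : Finset (Fin n)} {j : Fin n}
    (h : IsVertex v a I j) {Γ : Set (Set (Fin n → WithBot ℝ))} (hfin : Γ.Finite)
    (hΓ : Γ ⊆ supportingHalfSpaces (cone v)) (heq : ⋂₀ Γ = cone v) :
    ∃ J : Finset (Fin n), J.Nonempty ∧ J ≠ Finset.univ ∧ halfSpace a J ∈ Γ := by
  by_contra hcon
  have hev : ∀ H ∈ Γ, ∀ᶠ δ in nhdsWithin (0 : ℝ) (Set.Ioi 0), toMax (bump a j δ) ∈ H := by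
    intro H hH
    obtain ⟨b, J, hJ, hJ', rfl, hC, hb⟩ := hΓ hH
    refine h.eventually_bump_mem hp hv hJ hC hb ?_
    rintro ⟨c, hc⟩
    exact hcon ⟨J, hJ, hJ', halfSpace_eq_of_sub_const hc hJ ▸ hH⟩
  obtain ⟨δ, hδ, hpos⟩ := (((Filter.eventually_all_finite hfin).2 hev).and
    (eventually_mem_nhdsWithin (a := (0 : ℝ)) (s := Set.Ioi 0))).exists
  exact h.bump_notMem hpos (h.cone_subset hp (heq ▸ Set.mem_sInter.2 hδ))

/-! ### Apices of non-redundant half-spaces -/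

theorem sup_add_mem_halfSpaceOf {α : Fin n → ℝ} {I J : Finset (Fin n)} (hI : I.Nonempty)
    {x y : Fin n → WithBot ℝ} (hx : x ∈ halfSpaceOf α I J) (hy : y ∈ halfSpaceOf α I J) (t : ℝ) :
    (fun k => x k ⊔ (y k + (t : WithBot ℝ))) ∈ halfSpaceOf α I J := by
  rw [mem_halfSpaceOf_iff hI] at *
  intro j hj
  rcases le_total (y j + (t : WithBot ℝ)) (x j) with h | h
  · obtain ⟨i, hi, h'⟩ := hx j hj
    refine ⟨i, hi, ?_⟩
    simp only [sup_eq_left.2 h]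
    exact h'.trans (add_le_add le_sup_left le_rfl)
  · obtain ⟨i, hi, h'⟩ := hy j hj
    refine ⟨i, hi, ?_⟩
    simp only [sup_eq_right.2 h]
    rw [add_right_comm]
    refine (add_le_add h' le_rfl).trans ?_
    rw [add_right_comm]
    exact add_le_add le_sup_right le_rfl

theorem exists_typeSet_of_nonredundant {v : Fin p → Fin n → ℝ} (hp : 0 < p)
    {Γ : Set (Set (Fin n → WithBot ℝ))} (hΓ : IsNonredundantRep (cone v) Γ)
    {a : Fin n → ℝ} {I : Finset (Fin n)} (hI : I.Nonempty) (hmem : halfSpace a I ∈ Γ)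
    (hC : cone v ⊆ halfSpace a I) :
    ∃ j ∉ I, ∀ r, ∃ s ∈ typeSet v a j, ∀ k ∈ I, s ∈ typeSet v a k → r ∈ typeSet v a k := by
  obtain ⟨-, hsub, hinter, hred⟩ := hΓ
  obtain ⟨x, hxΓ, hx⟩ := Set.not_subset.1 (hred _ hmem)
  rw [mem_halfSpace_iff hI] at hx
  push Not at hx
  obtain ⟨j₀, -, hj₀⟩ := hx
  obtain ⟨j, -, hj⟩ := Finset.exists_max_image Finset.univ
    (fun k => x k + ((-a k : ℝ) : WithBot ℝ)) ⟨j₀, Finset.mem_univ _⟩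
  have hlt : ∀ i ∈ I, x i + ((-a i : ℝ) : WithBot ℝ) < x j + ((-a j : ℝ) : WithBot ℝ) :=
    fun i hi => (hj₀ i hi).trans_le (hj j₀ (Finset.mem_univ _))
  refine ⟨j, fun h => lt_irrefl _ (hlt j h), fun r => ?_⟩
  obtain ⟨m, hm⟩ : ∃ m : ℝ, (m : WithBot ℝ) = x j + ((-a j : ℝ) : WithBot ℝ) := by
    obtain ⟨i, hi⟩ := hI
    exact WithBot.ne_bot_iff_exists.1 (bot_le.trans_lt (hlt i hi)).ne'
  obtain ⟨i₁, hi₁, hr⟩ := (cone_subset_halfSpace_iff hp hI).1 hC r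
  -- The shift by `t - m` brings the maximum of `x - a` to that of `v r - a`; `w` is the join of `v
  -- r` with the shifted `x`.
  set t := v r i₁ - a i₁ with ht
  have hne : ∀ k, ((v r k : ℝ) : WithBot ℝ) ⊔ (x k + ((t - m : ℝ) : WithBot ℝ)) ≠ ⊥ :=
    fun k => ((WithBot.bot_lt_coe _).trans_le le_sup_left).ne'
  choose w hw using fun k => WithBot.ne_bot_iff_exists.1 (hne k)
  have hvw : ∀ k, v r k ≤ w k := fun k => WithBot.coe_le_coe.1 (hw k ▸ le_sup_left)
  have hcase : ∀ k, w k = v r k ∨ x k = ((w k - (t - m) : ℝ) : WithBot ℝ) := by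
    intro k
    rcases le_total (x k + ((t - m : ℝ) : WithBot ℝ)) (v r k : WithBot ℝ) with h | h
    · left
      have := hw k
      rw [sup_eq_left.2 h] at this
      exact WithBot.coe_injective this
    · right
      have := hw k
      rw [sup_eq_right.2 h] at this
      rw [sub_eq_add_neg, WithBot.coe_add, this, add_assoc, ← WithBot.coe_add]
      simp
  have hwle : ∀ k, w k ≤ a k + t := by
    intro k
    rcases hcase k with h | h
    · linarith [hr k]
    · have := hj k (Finset.mem_univ k)
      rw [h, ← hm] at this
      norm_cast at this
      linarith
  have hwj : a j + t ≤ w j := by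
    have h1 : x j + ((t - m : ℝ) : WithBot ℝ) ≤ w j := hw j ▸ le_sup_right
    have h2 : x j = ((m + a j : ℝ) : WithBot ℝ) := by
      rw [WithBot.coe_add, hm, add_assoc, ← WithBot.coe_add]
      simp
    rw [h2] at h1
    norm_cast at h1
    linarith
  have hwC : toMax w ∈ cone v := by
    rw [← hinter]
    intro H hH
    by_cases hHa : H = halfSpace a I
    · rw [hHa, toMax_mem_halfSpace_iff hI]
      exact fun k _ => ⟨i₁, hi₁, by linarith [hwle k, hvw i₁]⟩
    · obtain ⟨b, J, hJ, -, rfl, hCb, -⟩ := hsub hH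
      have := sup_add_mem_halfSpaceOf hJ (hCb (toMax_generator_mem_cone v r))
        (hxΓ _ ⟨hH, hHa⟩) (t - m)
      rwa [show (fun k => toMax (v r) k ⊔ (x k + ((t - m : ℝ) : WithBot ℝ))) = toMax w from
        funext fun k => (hw k).symm] at this
  -- As `w - a` is maximal at `j`, a generator attaining `w j` has type `j`. Its types in `I` are
  -- places where `w` meets `a + t`; there the shifted `x` is strictly lower, so `v r` is what meets
  -- it.
  obtain ⟨s, hs⟩ := (toMax_mem_cone_iff hp).1 hwC j
  refine ⟨s, fun k => by linarith [hs k, hwle k], fun k hk hsk => ?_⟩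
  have hwk : a k + t ≤ w k := by linarith [hs k, hsk j]
  rcases hcase k with h | h
  · intro l
    linarith [hr l]
  · have := hlt k hk
    rw [h, ← hm] at this
    norm_cast at this
    linarith

theorem exists_isVertex_of_nonredundant {v : Fin p → Fin n → ℝ} (hp : 0 < p)
    (hv : HasGenericExtremities v)
    {Γ : Set (Set (Fin n → WithBot ℝ))} (hΓ : IsNonredundantRep (cone v) Γ)
    {a : Fin n → ℝ} {I : Finset (Fin n)} (hI : I.Nonempty) (hI' : I ≠ Finset.univ)
    (hmem : halfSpace a I ∈ Γ) : ∃ J j, IsVertex v a J j := by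
  classical
  obtain ⟨hC, haC⟩ : cone v ⊆ halfSpace a I ∧ toMax a ∈ cone v := by
    obtain ⟨b, J, hJ, hJ', h, hC, hb⟩ := hΓ.2.1 hmem
    obtain ⟨-, c, hc⟩ := halfSpace_injective hI hI' hJ h
    exact ⟨hC, toMax_mem_cone_of_sub_const hp hc hb⟩
  obtain ⟨j, hj, hty⟩ := exists_typeSet_of_nonredundant hp hΓ hI hmem hC
  have hcov := (cone_subset_halfSpace_iff hp hI).1 hC
  have hcorner : ∀ r, ∃ s ∈ typeSet v a j,
      (∀ k ≠ j, s ∈ typeSet v a k → k ∈ I ∧ r ∈ typeSet v a k) ∧ IsCorner v s j := by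
    intro r
    obtain ⟨s, hsj, hs⟩ := hty r
    obtain ⟨q, hqj, hqs, hqI, hq⟩ := hv.exists_isCorner_typeSet hI hC hj hsj
    exact ⟨q, hqj, fun k hkj hk => ⟨hqI k hkj hk, hs k (hqI k hkj hk) (hqs k hk)⟩, hq⟩
  have hedge : ∀ r, ∃ i ∈ I, r ∈ typeSet v a i ∧ ∃ s, ∀ k, s ∈ typeSet v a k ↔ k = i ∨ k = j := by
    intro r
    obtain ⟨s, hsj, hs, hc⟩ := hcorner r
    obtain ⟨i, hi, hsi⟩ := hcov s
    have hij : i ≠ j := ne_of_mem_of_not_mem hi hj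
    refine ⟨i, hi, (hs i hij hsi).2, ?_⟩
    -- A generator `q` attaining coordinate `i` of the raised point has no type but `i`, so its
    -- corner `u` has exactly the types `i` and `j`.
    obtain ⟨δ, hδ, hmem⟩ := hc.2 i hij
    obtain ⟨q, hq⟩ := (toMax_mem_cone_iff hp).1 hmem i
    have hqi : ∀ k, q ∈ typeSet v a k → k = i := by
      intro k hk
      by_contra hki
      have h1 := hq k
      rw [bump_self, bump_of_ne _ _ hki] at h1
      linarith [hk i, hsi k]
    obtain ⟨u, huj, hu, -⟩ := hcorner q
    have hui : ∀ k ≠ j, u ∈ typeSet v a k → k = i := fun k hkj hk => hqi k (hu k hkj hk).2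
    refine ⟨u, fun k => ⟨fun hk => ?_, ?_⟩⟩
    · by_cases hkj : k = j
      · exact Or.inr hkj
      · exact Or.inl (hui k hkj hk)
    · rintro (rfl | rfl)
      · obtain ⟨i', hi', hui'⟩ := hcov u
        exact hui i' (ne_of_mem_of_not_mem hi' hj) hui' ▸ hui'
      · exact huj
  have hcov' : ∀ r, ∃ i ∈ I.filter fun i => ∃ s, ∀ k, s ∈ typeSet v a k ↔ k = i ∨ k = j,
      r ∈ typeSet v a i := by
    intro r
    obtain ⟨i, hi, hr, hs⟩ := hedge r
    exact ⟨i, Finset.mem_filter.2 ⟨hi, hs⟩, hr⟩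
  refine ⟨I.filter fun i => ∃ s, ∀ k, s ∈ typeSet v a k ↔ k = i ∨ k = j, j, ?_, ?_, ?_, ?_, ?_⟩
  · obtain ⟨i, hi, -⟩ := hcov' ⟨0, hp⟩
    exact ⟨i, hi⟩
  · exact fun h => hj (Finset.mem_filter.1 h).1
  · exact Set.eq_univ_of_forall fun r => by simpa using hcov' r
  · intro k _
    obtain ⟨r, hr⟩ := (toMax_mem_cone_iff_typeSet hp).1 haC k
    obtain ⟨i, hi, hri⟩ := hcov' r
    exact ⟨i, hi, r, hri, hr⟩
  · intro i hi hsub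
    obtain ⟨s, hs⟩ := (Finset.mem_filter.1 hi).2
    obtain ⟨k, hk, hsk⟩ := Set.mem_iUnion₂.1
      (hsub ⟨(hs i).2 (Or.inl rfl), (hs j).2 (Or.inr rfl)⟩)
    rw [Finset.mem_sdiff, Finset.mem_singleton] at hk
    rcases (hs k).1 hsk with rfl | rfl
    · exact hk.2 rfl
    · exact hj (Finset.mem_filter.1 hk.1).1

/-! ### Existence of external representations -/

/-- The new apex is the join of the generators, each translated as high as possible below `α` on
`I`; the new sectors are the places of `I` where it meets `α`. -/
theorem exists_supportingHalfSpace_subset {v : Fin p → Fin n → ℝ} (hp : 0 < p) {α : Fin n → ℝ}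
    {I : Finset (Fin n)} (hI : I.Nonempty) {j : Fin n} (hj : j ∉ I)
    (hC : cone v ⊆ halfSpaceOf α I {j}) :
    ∃ H ∈ supportingHalfSpaces (cone v), H ⊆ halfSpaceOf α I {j} := by
  classical
  have hne : (Finset.univ : Finset (Fin p)).Nonempty := ⟨⟨0, hp⟩, Finset.mem_univ _⟩
  choose m hmI hm using fun r => Finset.exists_min_image I (fun i => α i - v r i) hI
  choose q hq hmax using fun k =>
    Finset.exists_max_image Finset.univ (fun r => α (m r) - v r (m r) + v r k) hne
  have hmax' : ∀ k r, α (m r) - v r (m r) + v r k ≤ α (m (q k)) - v (q k) (m (q k)) + v (q k) k :=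
    fun k r => hmax k r (Finset.mem_univ r)
  set a : Fin n → ℝ := fun k => α (m (q k)) - v (q k) (m (q k)) + v (q k) k with ha
  have haα : ∀ i ∈ I, a i ≤ α i := fun i hi => by linarith [hm (q i) i hi]
  have hmem : ∀ r, m r ∈ I.filter fun i => a i = α i := fun r =>
    Finset.mem_filter.2 ⟨hmI r, le_antisymm (haα _ (hmI r)) (by linarith [hmax' (m r) r])⟩
  have hne' : (I.filter fun i => a i = α i).Nonempty := ⟨_, hmem ⟨0, hp⟩⟩
  have haj : a j ≤ α j := by
    obtain ⟨i, hi, h⟩ := (cone_subset_halfSpaceOf_iff hp hI).1 hC (q j) j (Finset.mem_singleton_self j)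
    have := hm (q j) i hi
    simp only [ha]
    linarith
  refine ⟨halfSpace a (I.filter fun i => a i = α i), ⟨a, _, hne', ?_, rfl, ?_, ?_⟩, ?_⟩
  · exact fun h => hj (Finset.mem_filter.1 (h ▸ Finset.mem_univ j)).1
  · rw [cone_subset_halfSpace_iff hp hne']
    refine fun r => ⟨m r, hmem r, fun k => ?_⟩
    linarith [hmax' k r, (Finset.mem_filter.1 (hmem r)).2]
  · rw [toMax_mem_cone_iff hp]
    refine fun k => ⟨q k, fun l => ?_⟩
    linarith [hmax' l (q k)]
  · intro x hx
    rw [mem_halfSpaceOf_iff hI]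
    intro k hk
    obtain rfl := Finset.mem_singleton.1 hk
    obtain ⟨i, hi, h⟩ := (mem_halfSpace_iff hne').1 hx k fun h => hj (Finset.mem_filter.1 h).1
    obtain ⟨hi, hai⟩ := Finset.mem_filter.1 hi
    refine ⟨i, hi, ?_⟩
    rw [withBot_add_neg_le_iff] at h ⊢
    exact (add_le_add le_rfl (WithBot.coe_le_coe.2 (by linarith))).trans h

/-- A point outside the cone has a coordinate `j` that no generator attains, hence for each `r` some
`f r` violating the comparison with `j`. The half-space built from `(j, f)` excludes it, and there
are finitely many such pairs. -/
theorem exists_supportingHalfSpace_of_choice {v : Fin p → Fin n → ℝ} (hp : 0 < p) {j : Fin n}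
    {f : Fin p → Fin n} (hf : ∀ r, f r ≠ j) :
    ∃ H ∈ supportingHalfSpaces (cone v), ∀ x ∈ H,
      ∃ r, x j + ((-v r j : ℝ) : WithBot ℝ) ≤ x (f r) + ((-v r (f r) : ℝ) : WithBot ℝ) := by
  classical
  have hj : j ∉ Finset.univ.image f := by simpa using hf
  have hI : (Finset.univ.image f).Nonempty := ⟨f ⟨0, hp⟩, by simp⟩
  have hex : ∀ k, ∃ r, k ∈ Finset.univ.image f →
      f r = k ∧ ∀ s, f s = k → v r k - v r j ≤ v s k - v s j := by
    intro k
    by_cases hk : k ∈ Finset.univ.image f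
    · obtain ⟨r, -, hr⟩ := Finset.mem_image.1 hk
      obtain ⟨q, hq, hmin⟩ := Finset.exists_min_image (Finset.univ.filter fun s => f s = k)
        (fun s => v s k - v s j) ⟨r, by simpa using hr⟩
      simp only [Finset.mem_filter, Finset.mem_univ, true_and] at hq hmin
      exact ⟨q, fun _ => ⟨hq, hmin⟩⟩
    · exact ⟨⟨0, hp⟩, fun h => absurd h hk⟩
  choose q hq using hex
  obtain ⟨H, hH, hsub⟩ := exists_supportingHalfSpace_subset (v := v) hp
    -- This `α` vanishes at `j` whatever `q j` is.
    (α := fun k => v (q k) k - v (q k) j) hI hj (by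
      rw [cone_subset_halfSpaceOf_iff hp hI]
      intro r k hk
      obtain rfl := Finset.mem_singleton.1 hk
      have hfr : f r ∈ Finset.univ.image f := by simp
      exact ⟨f r, hfr, by linarith [(hq _ hfr).2 r rfl]⟩)
  refine ⟨H, hH, fun x hx => ?_⟩
  obtain ⟨k, hk, h⟩ := (mem_halfSpaceOf_iff hI).1 (hsub hx) j (Finset.mem_singleton_self j)
  refine ⟨q k, ?_⟩
  rw [(hq k hk).1]
  rw [withBot_add_neg_le_iff] at h ⊢
  convert h using 3
  ring

theorem exists_finite_rep {v : Fin p → Fin n → ℝ} (hp : 0 < p) :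
    ∃ Γ : Set (Set (Fin n → WithBot ℝ)),
      Γ.Finite ∧ Γ ⊆ supportingHalfSpaces (cone v) ∧ ⋂₀ Γ = cone v := by
  choose G hG hsep using
    fun q : {q : Fin n × (Fin p → Fin n) // ∀ r, q.2 r ≠ q.1} =>
      exists_supportingHalfSpace_of_choice (v := v) hp q.2
  refine ⟨Set.range G, Set.finite_range G, Set.range_subset_iff.2 hG, ?_⟩
  apply Set.Subset.antisymm
  · intro x hx
    by_contra hxC
    rw [mem_cone_iff hp] at hxC
    push Not at hxC
    obtain ⟨j, hj⟩ := hxC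
    choose f hf using hj
    have hfj : ∀ r, f r ≠ j := fun r h => lt_irrefl _ (h ▸ hf r)
    obtain ⟨r, hr⟩ := hsep ⟨(j, f), hfj⟩ x (hx _ (Set.mem_range_self _))
    exact (hf r).not_ge hr
  · rintro x hx _ ⟨q, rfl⟩
    obtain ⟨-, -, -, -, -, hC, -⟩ := hG q
    exact hC hx

theorem exists_isNonredundantRep_subset {C : Set (Fin n → WithBot ℝ)}
    {Γ : Set (Set (Fin n → WithBot ℝ))} (hfin : Γ.Finite)
    (hΓ : Γ ⊆ supportingHalfSpaces C) (heq : ⋂₀ Γ = C) :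
    ∃ Γ' ⊆ Γ, IsNonredundantRep C Γ' := by
  obtain ⟨Γ', ⟨hsub, heq'⟩, hmin⟩ := (hfin.finite_subsets.subset
    (t := {Γ' | Γ' ⊆ Γ ∧ ⋂₀ Γ' = C}) fun _ h => h.1).exists_minimal ⟨Γ, subset_rfl, heq⟩
  refine ⟨Γ', hsub, hfin.subset hsub, hsub.trans hΓ, heq', fun H hH hcon => ?_⟩
  have hle : Γ' \ {H} ⊆ Γ' := Set.sdiff_subset
  have : Γ' ⊆ Γ' \ {H} := by
    refine hmin ⟨hle.trans hsub, ?_⟩ hle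
    rw [← heq']
    refine Set.Subset.antisymm (fun x hx K hK => ?_) (Set.sInter_subset_sInter hle)
    by_cases hKH : K = H
    · exact hKH ▸ hcon hx
    · exact hx K ⟨hK, hKH⟩
  exact (this hH).2 rfl

/-! ### The half-spaces of the vertices -/

theorem vertexHalfSpaces_subset_supportingHalfSpaces {v : Fin p → Fin n → ℝ} (hp : 0 < p) :
    vertexHalfSpaces v ⊆ supportingHalfSpaces (cone v) := by
  rintro _ ⟨a, I, j, h, rfl⟩
  exact ⟨a, I, h.nonempty, h.ne_univ, rfl, h.cone_subset hp, h.toMax_mem_cone hp⟩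

theorem IsVertex.halfSpace_eq_of_sub_const {v : Fin p → Fin n → ℝ} (hp : 0 < p)
    (hv : HasGenericExtremities v) {a b : Fin n → ℝ} {I J : Finset (Fin n)} {i j : Fin n}
    (ha : IsVertex v a I i) (hb : IsVertex v b J j) {c : ℝ} (h : ∀ k, a k = b k + c) :
    halfSpace a I = halfSpace b J := by
  obtain rfl := ha.sectors_unique hp hv (hb.of_sub_const h)
  exact TropicalCone.halfSpace_eq_of_sub_const h ha.nonempty

theorem finite_vertexHalfSpaces {v : Fin p → Fin n → ℝ} (hp : 0 < p)
    (hv : HasGenericExtremities v) : (vertexHalfSpaces v).Finite := by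
  obtain ⟨Γ, hfin, hsub, heq⟩ := exists_finite_rep (v := v) hp
  -- Each `K` in a finite representation fixes its apex up to a constant, hence at most one vertex
  -- half-space.
  refine (hfin.biUnion (t := fun K => {H | ∃ a I j J, IsVertex v a I j ∧ H = halfSpace a I ∧
    J.Nonempty ∧ J ≠ Finset.univ ∧ K = halfSpace a J}) fun K _ =>
      Set.Subsingleton.finite ?_).subset ?_
  · rintro _ ⟨a, I, i, J, h, rfl, hJ, hJ', rfl⟩ _ ⟨b, I', i', J', h', rfl, hJ₁, -, h₁⟩
    obtain ⟨-, c, hc⟩ := halfSpace_injective hJ hJ' hJ₁ h₁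
    exact h.halfSpace_eq_of_sub_const hp hv h' hc
  · rintro _ ⟨a, I, j, h, rfl⟩
    obtain ⟨J, hJ, hJ', hmem⟩ := h.exists_halfSpace_mem hp hv hfin hsub heq
    exact Set.mem_biUnion hmem ⟨a, I, j, J, h, rfl, hJ, hJ', rfl⟩

theorem isNonredundantRep_vertexHalfSpaces {v : Fin p → Fin n → ℝ} (hp : 0 < p)
    (hv : HasGenericExtremities v) : IsNonredundantRep (cone v) (vertexHalfSpaces v) := by
  have hfin := finite_vertexHalfSpaces hp hv
  have hsub := vertexHalfSpaces_subset_supportingHalfSpaces (v := v) hp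
  have heq : ⋂₀ vertexHalfSpaces v = cone v := by
    refine Set.Subset.antisymm ?_ ?_
    · obtain ⟨Γ₀, hfin₀, hsub₀, heq₀⟩ := exists_finite_rep (v := v) hp
      obtain ⟨Γ, -, hΓ⟩ := exists_isNonredundantRep_subset hfin₀ hsub₀ heq₀
      intro x hx
      rw [← hΓ.2.2.1]
      intro H hH
      obtain ⟨a, I, hI, hI', rfl, hC, -⟩ := hΓ.2.1 hH
      obtain ⟨J, j, h⟩ := exists_isVertex_of_nonredundant hp hv hΓ hI hI' hH
      exact halfSpace_mono h.nonempty (h.subset_of_cone_subset hv hI hC) (hx _ ⟨a, J, j, h, rfl⟩)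
    · rintro x hx _ ⟨a, I, j, h, rfl⟩
      exact h.cone_subset hp hx
  refine ⟨hfin, hsub, heq, ?_⟩
  rintro _ ⟨a, I, j, h, rfl⟩ hcon
  have hle : vertexHalfSpaces v \ {halfSpace a I} ⊆ vertexHalfSpaces v := Set.sdiff_subset
  have heq' : ⋂₀ (vertexHalfSpaces v \ {halfSpace a I}) = cone v := by
    rw [← heq]
    refine Set.Subset.antisymm (fun x hx K hK => ?_) (Set.sInter_subset_sInter hle)
    by_cases hKH : K = halfSpace a I
    · exact hKH ▸ hcon hx
    · exact hx K ⟨hK, hKH⟩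
  -- Were the half-space redundant, the others would represent the cone, so `a` would still be one
  -- of their apices.
  obtain ⟨J, hJ, hJ', ⟨b, J', j', h', e⟩, hne⟩ :=
    h.exists_halfSpace_mem hp hv (hfin.subset hle) (hle.trans hsub) heq'
  obtain ⟨rfl, c, hc⟩ := halfSpace_injective hJ hJ' h'.nonempty e
  exact hne (e.trans (h.halfSpace_eq_of_sub_const hp hv h' hc).symm)

/-- In a smaller half-space containing the cone, the generators of types `{i, j}` force the sectors
to be `I` and fix `α` on `I ∪ {j}`; `touch` fixes the remaining coordinates. -/
theorem IsVertex.isMinimalHalfSpace {v : Fin p → Fin n → ℝ} (hp : 0 < p)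
    (hv : HasGenericExtremities v) {a : Fin n → ℝ} {I : Finset (Fin n)} {j : Fin n}
    (h : IsVertex v a I j) : IsMinimalHalfSpace (cone v) (halfSpace a I) := by
  refine ⟨⟨⟨a, I, Iᶜ, h.nonempty, ⟨j, by simpa using h.notMem⟩, disjoint_compl_right, rfl⟩,
    h.cone_subset hp⟩, ?_⟩
  rintro _ ⟨⟨α, I₀, J₀, hI₀, hJ₀, hdisj, rfl⟩, hC⟩ hle
  obtain ⟨hsubI, hsubJ, hα⟩ := halfSpaceOf_subset_halfSpace hI₀ hdisj h.nonempty hle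
  rw [cone_subset_halfSpaceOf_iff hp hI₀] at hC
  have hII : ∀ i ∈ I, i ∈ I₀ ∧ α i - α j ≤ a i - a j := by
    intro i hi
    obtain ⟨s, hs, -⟩ := h.exists_typeSet_iff hv hi
    have hsi : s ∈ typeSet v a i := (hs i).2 (Or.inl rfl)
    have hsj : s ∈ typeSet v a j := (hs j).2 (Or.inr rfl)
    obtain ⟨k, hk, hle⟩ := hC s j (hsubJ (Finset.mem_compl.2 h.notMem))
    have hkj := hα k hk j h.notMem
    have hsk : s ∈ typeSet v a k := fun l => by linarith [hsj l]
    rcases (hs k).1 hsk with rfl | rfl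
    · exact ⟨hk, by linarith [hsj k]⟩
    · exact absurd (hsubI hk) h.notMem
  obtain rfl : I₀ = I := hsubI.antisymm fun i hi => (hII i hi).1
  obtain rfl : J₀ = I₀ᶜ :=
    Finset.Subset.antisymm (fun k hk => Finset.mem_compl.2 (Finset.disjoint_right.1 hdisj hk)) hsubJ
  have hcst : ∃ c, ∀ k, a k = α k + c := by
    refine ⟨a j - α j, fun k => ?_⟩
    have hI : ∀ i ∈ I₀, a i = α i + (a j - α j) :=
      fun i hi => by linarith [(hII i hi).2, hα i hi j h.notMem]
    by_cases hk : k ∈ I₀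
    · exact hI k hk
    · obtain ⟨i, hi, r, hri, hrk⟩ := h.touch k hk
      obtain ⟨i', hi', hle⟩ := hC r k (Finset.mem_compl.2 hk)
      linarith [hI i' hi', hI i hi, hα i hi k hk, hrk i', hri k]
  obtain ⟨c, hc⟩ := hcst
  exact (TropicalCone.halfSpace_eq_of_sub_const hc h.nonempty).subset

end TropicalCone

/-! ### The main theorem -/

theorem mainTheorem9 (n p : ℕ) (hp : 0 < p) (v : Fin p → Fin n → ℝ)
    (hv : TropicalCone.HasGenericExtremities v) :
    -- the non-redundant apices are the vertices, whatever the representation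
    (TropicalCone.nonredundantApices (TropicalCone.cone v) =
        {a | ∃ (I : Finset (Fin n)) (j : Fin n), TropicalCone.IsVertex v a I j} ∧
      ∀ Γ, TropicalCone.IsNonredundantRep (TropicalCone.cone v) Γ →
        TropicalCone.apices Γ = TropicalCone.nonredundantApices (TropicalCone.cone v)) ∧
    -- the set of sectors of a vertex is uniquely determined
    (∀ (a : Fin n → ℝ) (I I' : Finset (Fin n)) (j j' : Fin n),
      TropicalCone.IsVertex v a I j → TropicalCone.IsVertex v a I' j' → I = I') ∧
    -- the half-spaces of the vertices form a non-redundant representation by minimal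
    -- half-spaces, and it is the only one
    (TropicalCone.IsNonredundantRep (TropicalCone.cone v) (TropicalCone.vertexHalfSpaces v) ∧
      (∀ H ∈ TropicalCone.vertexHalfSpaces v,
        TropicalCone.IsMinimalHalfSpace (TropicalCone.cone v) H) ∧
      ∀ Γ, TropicalCone.IsNonredundantRep (TropicalCone.cone v) Γ →
        (∀ H ∈ Γ, TropicalCone.IsMinimalHalfSpace (TropicalCone.cone v) H) →
          Γ = TropicalCone.vertexHalfSpaces v) := by
  have happ : ∀ Γ, TropicalCone.IsNonredundantRep (TropicalCone.cone v) Γ →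
      TropicalCone.apices Γ =
        {a | ∃ (I : Finset (Fin n)) (j : Fin n), TropicalCone.IsVertex v a I j} := by
    intro Γ hΓ
    ext a
    constructor
    · rintro ⟨I, hI, hI', hmem⟩
      exact TropicalCone.exists_isVertex_of_nonredundant hp hv hΓ hI hI' hmem
    · rintro ⟨I, j, h⟩
      exact h.exists_halfSpace_mem hp hv hΓ.1 hΓ.2.1 hΓ.2.2.1
  have hrep := TropicalCone.isNonredundantRep_vertexHalfSpaces hp hv
  have hmain : TropicalCone.nonredundantApices (TropicalCone.cone v) =
      {a | ∃ (I : Finset (Fin n)) (j : Fin n), TropicalCone.IsVertex v a I j} := by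
    ext a
    constructor
    · rintro ⟨Γ, hΓ, ha⟩
      rwa [happ Γ hΓ] at ha
    · intro ha
      exact ⟨_, hrep, by rwa [happ _ hrep]⟩
  refine ⟨⟨hmain, fun Γ hΓ => (happ Γ hΓ).trans hmain.symm⟩,
    fun a I I' j j' h h' => h.sectors_unique hp hv h', hrep, ?_, fun Γ hΓ hmin => ?_⟩
  · rintro _ ⟨a, I, j, h, rfl⟩
    exact h.isMinimalHalfSpace hp hv
  -- The vertex half-space with apex `a` lies inside any half-space of `Γ` with that apex, so
  -- minimality makes them equal.
  have hmem : ∀ a I J j, I.Nonempty → I ≠ Finset.univ → TropicalCone.halfSpace a I ∈ Γ →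
      TropicalCone.IsVertex v a J j →
      TropicalCone.halfSpace a I = TropicalCone.halfSpace a J := by
    intro a I J j hI hI' hH h
    have hm := hmin _ hH
    have hsub := TropicalCone.halfSpace_mono (a := a) h.nonempty
      (h.subset_of_cone_subset hv hI hm.1.2)
    exact (hm.2 (h.isMinimalHalfSpace hp hv).1 hsub).antisymm hsub
  apply Set.Subset.antisymm
  · intro H hH
    obtain ⟨a, I, hI, hI', rfl, -, -⟩ := hΓ.2.1 hH
    obtain ⟨J, j, h⟩ := TropicalCone.exists_isVertex_of_nonredundant hp hv hΓ hI hI' hH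
    exact ⟨a, J, j, h, hmem a I J j hI hI' hH h⟩
  · rintro _ ⟨a, J, j, h, rfl⟩
    obtain ⟨I, hI, hI', hH⟩ := h.exists_halfSpace_mem hp hv hΓ.1 hΓ.2.1 hΓ.2.2.1
    exact hmem a I J j hI hI' hH h ▸ hH
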